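/- **Setting.** Let $\theta=[\psi^\top,y^\top]^\top\in\mathbb R^p$ with $\psi\in\mathbb R^q$, $y\in\mathbb R^\ell$, $p=q+\ell$. Given are $A(y)\in\mathbb R^{m\times n}$, $Q_x(\psi)\in\mathbb R^{n\times n}$, $R(\psi)\in\mathbb R^{m\times m}$, vectors $\mu_x\in\mathbb R^n$, $b\in\mathbb R^m$, and hyperprior densities $\pi_\psi,\pi_y$; put $\pi_\theta(\theta)=\pi_y(y)\,\pi_\psi(\psi)$, $$\Psi(\theta)=A(y)Q_x(\psi)A(y)^\top+R(\psi),\qquad \|v\|_K^2=v^\top K v,$$ $$\mathcal F(\theta)=-\log\pi_\theta(\theta)+\tfrac12\log\det\Psi(\theta)+\tfrac12\|A(y)\mu_x-b\|^2_{\Psi(\theta)^{-1}} .$$ For vectors $w_1,\dots,w_N\in\mathbb R^m$ and an anchor $\theta'$ let $$\widehat{\mathcal G}_{N}(\theta\mid\theta')=-\log\pi_\theta(\theta)+\frac1{2N}\sum_{i=1}^{N} w_i^\top\Psi(\theta')^{-1}\Psi(\theta)w_i+\tfrac12\|A(y)\mu_x-b\|^2_{\Psi(\theta)^{-1}} .$$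 **Assumptions.** Let $\Theta\subset\mathbb R^p$ be compact and convex and contained in a closed Euclidean ball of radius $r>0$. On $\Theta$, $Q_x$ and $R$ are symmetric positive definite and $\pi_\psi,\pi_y$ are positive. There are $L_\Psi>0$ and $0<\alpha\le\beta$ such that $\|\Psi(\theta)-\Psi(\theta')\|_2\le L_\Psi\|\theta-\theta'\|_2$ and $\alpha I\preceq\Psi(\theta)\preceq\beta I$ for all $\theta,\theta'\in\Theta$. The maps $\theta\mapsto A(y)\mu_x$, $\theta\mapsto\Psi(\theta)$ and $\theta\mapsto\log\pi_\theta(\theta)$ are differentiable on $\Theta$ with Lipschitz continuous derivatives on $\Theta$ (derivatives at points of $\Theta$ are taken relative to $\Theta$; functions that are differentiable in a neighbourhood of $\Theta$, with derivative Lipschitz on $\Theta$, are included). Let $(\varepsilon_t)_{t\ge0}$ and $(\delta_t)_{t\ge0}$ be positive sequences with $\sum_t\varepsilon_t<\infty$ and $\sum_t\delta_t=\delta<1$, and put $$\gamma_t=\max\Big\{\Big(\frac{12\,r\,m\,L_\Psi}{\varepsilon_t\,\alpha}\Big)^p,\,1\Big\},\qquad \varsigma_F=\frac1\alpha\max_{\theta\in\Theta}\|\Psi(\theta)\|_F,\qquad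 \varsigma_2=\frac1\alpha\max_{\theta\in\Theta}\|\Psi(\theta)\|_2 .$$ Let the sample sizes $N_t$ satisfy, for all $t\ge0$, $$N_t\ \ge\ \frac{16\,(2\varsigma_F^2+\varepsilon_t\varsigma_2)}{\varepsilon_t^2}\,\ln\Big(\frac{2\gamma_t}{\delta_t}\Big).$$ **Iteration.** For each $t\ge 0$ let $w_{t,1},\dots,w_{t,N_t}$ be independent Rademacher vectors, i.e. each uniformly distributed on $\{\pm1\}^m$ (nothing is assumed about the dependence between the samples of different iterations, so they may be fresh or reused). Let $(\widehat\theta_t)_{t\ge0}$ be a random sequence such that, almost surely, $\widehat\theta_0\in\Theta$ and for every $t\ge0$ $$\widehat\theta_{t+1}\in\operatorname*{arg\,min}_{\theta\in\Theta}\widehat{\mathcal G}_{N_t}(\theta\mid\widehat\theta_t),$$ where $\widehat{\mathcal G}_{N_t}$ is built from $w_{t,1},\dots,w_{t,N_t}$. **Theorem.** With probability at least $1-\delta$, every accumulation point $\theta^*$ of $(\widehat\theta_t)_{t\ge0}$ is a first-order stationary point of $\mathcal F$ over $\Theta$, that is, $\theta^*\in\Theta$, $\mathcal F$ is differentiable at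 $\theta^*$ relative to $\Theta$, and $$\langle\nabla\mathcal F(\theta^*),\theta-\theta^*\rangle\ge0\qquad\text{for all }\theta\in\Theta .$$ -/

import Mathlib

open MeasureTheory ProbabilityTheory Filter Topology
open scoped Matrix Matrix.Norms.L2Operator ENNReal

noncomputable section

namespace M3C

/-- Hyperparameter space `ℝ^p`, `p = q + ℓ`, of vectors `θ = [ψ; y]` with `ψ ∈ ℝ^q`, `y ∈ ℝ^ℓ`. -/
abbrev Param (q ℓ : ℕ) : Type := EuclideanSpace ℝ (Fin q ⊕ Fin ℓ)

/-- The block `ψ` of `θ = [ψ; y]`. -/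
def psiPart {q ℓ : ℕ} (θ : Param q ℓ) : EuclideanSpace ℝ (Fin q) :=
  WithLp.toLp 2 fun i => θ (Sum.inl i)

/-- The block `y` of `θ = [ψ; y]`. -/
def yPart {q ℓ : ℕ} (θ : Param q ℓ) : EuclideanSpace ℝ (Fin ℓ) :=
  WithLp.toLp 2 fun i => θ (Sum.inr i)

/-- The data of a hierarchical Bayesian linear inverse problem
`b = A(y) x + e`, `e ∼ N(0, R(ψ))`, `x ∼ N(μ_x, Q_x(ψ))`, `ψ ∼ π_ψ`, `y ∼ π_y`. -/
structure Model (q ℓ n m : ℕ) where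
  /-- forward operator `A(y)` -/
  A : EuclideanSpace ℝ (Fin ℓ) → Matrix (Fin m) (Fin n) ℝ
  /-- prior covariance `Q_x(ψ)` -/
  Q : EuclideanSpace ℝ (Fin q) → Matrix (Fin n) (Fin n) ℝ
  /-- noise covariance `R(ψ)` -/
  R : EuclideanSpace ℝ (Fin q) → Matrix (Fin m) (Fin m) ℝ
  /-- prior mean `μ_x` -/
  meanX : Fin n → ℝ
  /-- observed data `b` -/
  b : Fin m → ℝ
  /-- hyperprior density `π_ψ` -/
  priorPsi : EuclideanSpace ℝ (Fin q) → ℝ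
  /-- hyperprior density `π_y` -/
  priorY : EuclideanSpace ℝ (Fin ℓ) → ℝ

variable {q ℓ n m : ℕ}

namespace Model

/-- `Ψ(θ) = A(y) Q_x(ψ) A(y)ᵀ + R(ψ)`. -/
def Psi (M : Model q ℓ n m) (θ : Param q ℓ) : Matrix (Fin m) (Fin m) ℝ :=
  M.A (yPart θ) * M.Q (psiPart θ) * (M.A (yPart θ))ᵀ + M.R (psiPart θ)

/-- The predicted mean `A(y) μ_x`. -/
def predMean (M : Model q ℓ n m) (θ : Param q ℓ) : EuclideanSpace ℝ (Fin m) :=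
  WithLp.toLp 2 (M.A (yPart θ) *ᵥ M.meanX)

/-- `log π_θ(θ)` with `π_θ(θ) = π_y(y) π_ψ(ψ)`. -/
def logPrior (M : Model q ℓ n m) (θ : Param q ℓ) : ℝ :=
  Real.log (M.priorY (yPart θ) * M.priorPsi (psiPart θ))

/-- The data misfit `‖A(y) μ_x - b‖²_{Ψ(θ)⁻¹}`, where `‖v‖²_K = vᵀ K v`. -/
def misfit (M : Model q ℓ n m) (θ : Param q ℓ) : ℝ :=
  (M.A (yPart θ) *ᵥ M.meanX - M.b) ⬝ᵥ ((M.Psi θ)⁻¹ *ᵥ (M.A (yPart θ) *ᵥ M.meanX - M.b))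

/-- The negative log marginal posterior, up to an additive constant:
`F(θ) = -log π_θ(θ) + ½ log det Ψ(θ) + ½ ‖A(y) μ_x - b‖²_{Ψ(θ)⁻¹}`. -/
def objective (M : Model q ℓ n m) (θ : Param q ℓ) : ℝ :=
  -M.logPrior θ + (1 / 2) * Real.log (M.Psi θ).det + (1 / 2) * M.misfit θ

/-- The Monte Carlo surrogate anchored at `θ'` and built from the sample vectors `w 0, …, w (N-1)`:
`-log π_θ(θ) + (1 / (2 N)) ∑ᵢ zᵢᵀ Ψ(θ) wᵢ + ½ ‖A(y) μ_x - b‖²_{Ψ(θ)⁻¹}`, `zᵢ = Ψ(θ')⁻¹ wᵢ`. -/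
def mcSurrogate (M : Model q ℓ n m) {N : ℕ} (w : Fin N → Fin m → ℝ)
    (θ θ' : Param q ℓ) : ℝ :=
  -M.logPrior θ
    + 1 / (2 * (N : ℝ)) * ∑ i, ((M.Psi θ')⁻¹ *ᵥ w i) ⬝ᵥ (M.Psi θ *ᵥ w i)
    + (1 / 2) * M.misfit θ

/-- `θhat` is a run of the M³C iteration on `Θ` for the samples `w t i`, `i < N t`: it starts
in `Θ`, and `θhat (t+1)` is a (any) minimizer over `Θ` of the Monte Carlo surrogate anchored
at `θhat t`. -/
def IsRun (M : Model q ℓ n m) (Θ : Set (Param q ℓ)) {N : ℕ → ℕ}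
    (w : (t : ℕ) → Fin (N t) → Fin m → ℝ) (θhat : ℕ → Param q ℓ) : Prop :=
  θhat 0 ∈ Θ ∧ ∀ t, θhat (t + 1) ∈ Θ ∧
    IsMinOn (fun θ => M.mcSurrogate (w t) θ (θhat t)) Θ (θhat (t + 1))

/-- `ς_F = α⁻¹ max_{θ ∈ Θ} ‖Ψ(θ)‖_F`. -/
def sigmaF (M : Model q ℓ n m) (Θ : Set (Param q ℓ)) (α : ℝ) : ℝ :=
  1 / α * sSup ((fun θ => Real.sqrt (∑ i, ∑ j, (M.Psi θ i j) ^ 2)) '' Θ)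

/-- `ς_2 = α⁻¹ max_{θ ∈ Θ} ‖Ψ(θ)‖₂` (spectral norm). -/
def sigmaTwo (M : Model q ℓ n m) (Θ : Set (Param q ℓ)) (α : ℝ) : ℝ :=
  1 / α * sSup ((fun θ => ‖M.Psi θ‖) '' Θ)

end Model

/-- `f` has a Lipschitz continuous derivative on `s`. Derivatives are taken relative to `s`, so that
only the values of `f` on `s` matter; this holds in particular when `f` is differentiable on
a neighbourhood of `s` and its derivative is Lipschitz on `s`. -/
def HasLipschitzDerivOn {E F : Type*} [NormedAddCommGroup E] [NormedSpace ℝ E]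
    [NormedAddCommGroup F] [NormedSpace ℝ F] (f : E → F) (s : Set E) : Prop :=
  ∃ (f' : E → E →L[ℝ] F) (K : NNReal),
    (∀ x ∈ s, HasFDerivWithinAt f (f' x) s x) ∧ LipschitzOnWith K f' s

/-- First-order stationarity of `x` for the minimization of `f` over `s`: `f` has a gradient `g`
at `x` relative to `s`, and every such `g` satisfies `⟪g, y - x⟫ ≥ 0` for all `y ∈ s`.
If `f` is differentiable at `x`, the usual gradient `∇ f x` is one of these `g`. -/
def IsStationaryOn {E : Type*} [NormedAddCommGroup E] [InnerProductSpace ℝ E] [CompleteSpace E]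
    (f : E → ℝ) (s : Set E) (x : E) : Prop :=
  x ∈ s ∧ (∃ g : E, HasGradientWithinAt f g s x) ∧
    ∀ g : E, HasGradientWithinAt f g s x → ∀ y ∈ s, 0 ≤ inner ℝ g (y - x)

/-- The uniform distribution on `{1, -1}`. -/
def rademacher : Measure ℝ :=
  (1 / 2 : ℝ≥0∞) • Measure.dirac 1 + (1 / 2 : ℝ≥0∞) • Measure.dirac (-1)

/-- The uniform distribution on `{1, -1}^m`. -/
def rademacherVector (m : ℕ) : Measure (Fin m → ℝ) :=
  Measure.pi fun _ => rademacher

/-- The covering factor `γ = max {(12 r m L / (ε α))^p, 1}`. -/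
def coveringFactor (p m : ℕ) (r L α ε : ℝ) : ℝ :=
  max ((12 * r * m * L / (ε * α)) ^ p) 1

end M3C

end

/-! The proof is inexact majorization-minimization with summable errors. By `mcSurrogate_eq`, the
surrogate anchored at `θ'` equals the objective, plus half the log-determinant divergence
`logDetGap`, plus a term depending only on `θ'`, plus half the pairing of `Ψ(θ')⁻¹ Ψ(θ)` with the
deviation `momentError` of the empirical second moments from the identity. The divergence is
nonnegative, vanishes at the anchor and is `O(‖θ - θ'‖²)` on `Θ`.

Compactness bounds the entries of `Ψ(θ')⁻¹ Ψ(θ)` uniformly, so the whole Monte Carlo error is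
controlled by `momentError`, which involves only the samples. Hence no covering of `Θ` is needed,
and the dependence of the iterates on the samples is harmless. Hoeffding's inequality for each entry
and union bounds over entries and iterations give `|momentError| ≤ m ε_t` for all `t` with
probability at least `1 - δ`.

On that event the objective decreases up to summable errors. A cluster point `y` then satisfies `F y
≤ F z + ½ logDetGap z y` on `Θ` (`le_add_of_mapClusterPt`), and since the divergence is of second
order, `y` is stationary. -/

noncomputable section

namespace M3C

/-! ### Log-determinant inequalities and calculus on matrices -/

section MatrixLemmas

variable {m : ℕ}

open scoped MatrixOrder in
theorem exists_isUnit_eq_conjTranspose_mul_self {A : Matrix (Fin m) (Fin m) ℝ} (hA : A.PosDef) :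
    ∃ C : Matrix (Fin m) (Fin m) ℝ, IsUnit C ∧ A = Cᴴ * C := by
  obtain ⟨C, hC⟩ := CStarAlgebra.nonneg_iff_eq_star_mul_self.mp hA.posSemidef.nonneg
  rw [Matrix.star_eq_conjTranspose] at hC
  refine ⟨C, ?_, hC⟩
  have h := hA.det_pos.ne'
  rw [hC, Matrix.det_mul] at h
  exact (Matrix.isUnit_iff_isUnit_det C).2 (right_ne_zero_of_mul h).isUnit

/-- Concavity of `log det`: writing `A⁻¹ = Cᴴ C`, both sides depend only on the eigenvalues of `C B
Cᴴ`, where `log x ≤ x - 1` applies. -/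
theorem log_det_sub_log_det_le {A B : Matrix (Fin m) (Fin m) ℝ} (hA : A.PosDef) (hB : B.PosDef) :
    Real.log B.det - Real.log A.det ≤ (A⁻¹ * B).trace - m := by
  obtain ⟨C, hC, hCA⟩ := exists_isUnit_eq_conjTranspose_mul_self hA.inv
  have hP : (C * B * Cᴴ).PosDef :=
    hB.mul_mul_conjTranspose_same (Matrix.vecMul_injective_of_isUnit hC)
  have htr : (A⁻¹ * B).trace = (C * B * Cᴴ).trace := by
    rw [hCA, Matrix.mul_assoc, Matrix.trace_mul_comm]
  have hdet : Real.log B.det - Real.log A.det = Real.log (C * B * Cᴴ).det := by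
    have h1 : (C * B * Cᴴ).det = (A⁻¹).det * B.det := by
      rw [hCA]; simp only [Matrix.det_mul]; ring
    rw [h1, Matrix.det_nonsing_inv, Ring.inverse_eq_inv', Real.log_mul
      (inv_ne_zero hA.det_pos.ne') hB.det_pos.ne', Real.log_inv]
    ring
  rw [htr, hdet, hP.1.det_eq_prod_eigenvalues, hP.1.trace_eq_sum_eigenvalues]
  simp only [RCLike.ofReal_real_eq_id, id_eq]
  rw [Real.log_prod (fun i _ => (hP.eigenvalues_pos i).ne')]
  calc ∑ i, Real.log (hP.1.eigenvalues i) ≤ ∑ i, (hP.1.eigenvalues i - 1) :=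
        Finset.sum_le_sum fun i _ => Real.log_le_sub_one_of_pos (hP.eigenvalues_pos i)
    _ = _ := by simp

/-- The tangent inequality with `A` and `B` exchanged bounds the divergence by `tr(A⁻¹B) + tr(B⁻¹A)
- 2m`, which is exactly the right-hand side and is quadratic in `B - A`. -/
theorem trace_sub_log_det_le {A B : Matrix (Fin m) (Fin m) ℝ} (hA : A.PosDef) (hB : B.PosDef) :
    (A⁻¹ * B).trace - m - (Real.log B.det - Real.log A.det) ≤
      ((B - A) * A⁻¹ * (B - A) * B⁻¹).trace := by
  have h := log_det_sub_log_det_le hB hA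
  have hAu : IsUnit A.det := hA.det_pos.ne'.isUnit
  have hBu : IsUnit B.det := hB.det_pos.ne'.isUnit
  have e : (B - A) * A⁻¹ * (B - A) * B⁻¹ = B * A⁻¹ - 1 - (1 - A * B⁻¹) := by
    have h1 : (B - A) * A⁻¹ = B * A⁻¹ - 1 := by
      rw [Matrix.sub_mul, Matrix.mul_nonsing_inv _ hAu]
    have h2 : (B - A) * B⁻¹ = 1 - A * B⁻¹ := by
      rw [Matrix.sub_mul, Matrix.mul_nonsing_inv _ hBu]
    rw [Matrix.mul_assoc, h1, h2, Matrix.sub_mul, Matrix.one_mul, Matrix.mul_sub, Matrix.mul_one,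
      Matrix.mul_assoc, ← Matrix.mul_assoc A⁻¹, Matrix.nonsing_inv_mul _ hAu, Matrix.one_mul,
      Matrix.mul_nonsing_inv _ hBu]
  rw [e]
  simp only [Matrix.trace_sub, Matrix.trace_one, Fintype.card_fin]
  rw [Matrix.trace_mul_comm B, Matrix.trace_mul_comm A]
  linarith

/-- A linear functional on matrices as a continuous linear map for the spectral norm. -/
def matrixFunctional (f : Matrix (Fin m) (Fin m) ℝ →ₗ[ℝ] ℝ) : Matrix (Fin m) (Fin m) ℝ →L[ℝ] ℝ :=
  LinearMap.toContinuousLinearMap f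

theorem differentiable_entry (i j : Fin m) :
    Differentiable ℝ fun X : Matrix (Fin m) (Fin m) ℝ => X i j :=
  (matrixFunctional (Matrix.entryLinearMap ℝ ℝ i j)).differentiable

theorem differentiable_trace :
    Differentiable ℝ fun X : Matrix (Fin m) (Fin m) ℝ => X.trace :=
  (matrixFunctional (Matrix.traceLinearMap (Fin m) ℝ ℝ)).differentiable

theorem differentiable_det :
    Differentiable ℝ fun X : Matrix (Fin m) (Fin m) ℝ => X.det := by
  simp only [Matrix.det_apply']
  refine Differentiable.fun_sum fun σ _ => (differentiable_const _).mul ?_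
  exact fun X => (HasFDerivAt.finsetProd fun i _ =>
    (differentiable_entry (σ i) i X).hasFDerivAt).differentiableAt

theorem abs_trace_le : ∃ K, ∀ X : Matrix (Fin m) (Fin m) ℝ, |X.trace| ≤ K * ‖X‖ :=
  ⟨‖matrixFunctional (Matrix.traceLinearMap (Fin m) ℝ ℝ)‖,
    fun X => (matrixFunctional (Matrix.traceLinearMap (Fin m) ℝ ℝ)).le_opNorm X⟩

theorem abs_entry_le :
    ∃ K, ∀ (X : Matrix (Fin m) (Fin m) ℝ) (i j : Fin m), |X i j| ≤ K * ‖X‖ := by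
  have h : ∀ p : Fin m × Fin m, ∃ K : ℝ, ∀ X : Matrix (Fin m) (Fin m) ℝ,
      |X p.1 p.2| ≤ K * ‖X‖ := fun p =>
    ⟨_, fun X => (matrixFunctional (Matrix.entryLinearMap ℝ ℝ p.1 p.2)).le_opNorm X⟩
  choose K hK using h
  refine ⟨∑ p, |K p|, fun X i j => (hK (i, j) X).trans
    (mul_le_mul_of_nonneg_right ((le_abs_self _).trans ?_) (norm_nonneg X))⟩
  exact Finset.single_le_sum (f := fun p => |K p|) (fun p _ => abs_nonneg _)
    (Finset.mem_univ (i, j))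

theorem differentiableAt_nonsing_inv {X : Matrix (Fin m) (Fin m) ℝ} (hX : IsUnit X) :
    DifferentiableAt ℝ (fun X : Matrix (Fin m) (Fin m) ℝ => X⁻¹) X := by
  simp only [Matrix.nonsing_inv_eq_ringInverse]
  exact differentiableAt_inverse hX

end MatrixLemmas

/-! ### Stationarity and inexact majorization-minimization -/

/-- The quadratic has zero derivative at `x`, so adding it turns `x` into a minimizer on `s` without
changing the gradient there. -/
theorem inner_nonneg_of_quadratic_lower_bound {E : Type*} [NormedAddCommGroup E]
    [InnerProductSpace ℝ E] [CompleteSpace E] {f : E → ℝ} {s : Set E} {x g y : E}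
    (hs : Convex ℝ s) (hx : x ∈ s) (hy : y ∈ s) (hg : HasGradientWithinAt f g s x) {K : ℝ}
    (hK : ∀ z ∈ s, f x ≤ f z + K * ‖z - x‖ ^ 2) : 0 ≤ inner ℝ g (y - x) := by
  have hsq : HasFDerivWithinAt (fun z => K * ‖z - x‖ ^ 2) (0 : E →L[ℝ] ℝ) s x := by
    have h := (((hasFDerivAt_id x).sub_const x).norm_sq.const_mul K).hasFDerivWithinAt (s := s)
    refine h.congr_fderiv ?_
    ext v
    simp
  have h := hg.hasFDerivWithinAt.add hsq
  have hmin : IsLocalMinOn (f + fun z => K * ‖z - x‖ ^ 2) s x := by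
    refine eventually_nhdsWithin_of_forall fun z hz => ?_
    simpa using hK z hz
  have := hmin.hasFDerivWithinAt_nonneg h
    (sub_mem_posTangentConeAt_of_segment_subset (hs.segment_subset hx hy))
  simpa using this

/-- Cluster points of an inexact majorization-minimization sequence with summable errors `e` do not
improve under the majorizer `z ↦ f z + D z x` anchored at them. -/
theorem le_add_of_mapClusterPt {E : Type*} [TopologicalSpace E] [FirstCountableTopology E]
    {s : Set E} (hs : IsClosed s) {f : E → ℝ} {D : E → E → ℝ} (hf : ContinuousOn f s)
    (hD : ∀ z ∈ s, ContinuousOn (D z) s) (hD0 : ∀ z ∈ s, D z z ≤ 0)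
    {e : ℕ → ℝ} (he : Summable e) {x : ℕ → E} (hx : ∀ t, x t ∈ s)
    (hstep : ∀ t, ∀ z ∈ s, f (x (t + 1)) ≤ f z + D z (x t) + e t) {y : E}
    (hy : MapClusterPt y atTop x) : y ∈ s ∧ ∀ z ∈ s, f y ≤ f z + D z y := by
  obtain ⟨φ, hφ, hlim⟩ := hy.tendsto_subseq
  have hys : y ∈ s := hs.mem_of_tendsto hlim (Eventually.of_forall fun k => hx _)
  have hlim' : Tendsto (x ∘ φ) atTop (𝓝[s] y) :=
    tendsto_nhdsWithin_iff.2 ⟨hlim, Eventually.of_forall fun k => hx _⟩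
  set tail : ℕ → ℝ := fun t => ∑' k, e (k + t) with htail
  have htail0 : Tendsto tail atTop (𝓝 0) := tendsto_sum_nat_add e
  have htail_succ : ∀ t, tail t = e t + tail (t + 1) := fun t => by
    have h := ((summable_nat_add_iff t).2 he).tsum_eq_zero_add
    simp only [htail, h, zero_add]
    congr 1
    exact tsum_congr fun k => by congr 1; ring
  -- Taking the current iterate as competitor makes the objective decrease up to `e t`; adding the
  -- remaining error sum restores exact monotonicity.
  have hanti : Antitone fun t => f (x t) + tail t := antitone_nat_of_succ_le fun t => by
    have h1 := hstep t (x t) (hx t)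
    have h2 := hD0 (x t) (hx t)
    have h3 := htail_succ t
    linarith
  have hfy : Tendsto (fun k => f (x (φ k)) + tail (φ k)) atTop (𝓝 (f y)) := by
    simpa using ((hf y hys).tendsto.comp hlim').add (htail0.comp hφ.tendsto_atTop)
  have hle : ∀ t, f y ≤ f (x t) + tail t := fun t =>
    le_of_tendsto hfy ((hφ.tendsto_atTop.eventually_ge_atTop t).mono fun k hk => hanti hk)
  refine ⟨hys, fun z hz => ?_⟩
  have hlim2 : Tendsto (fun k => f z + D z (x (φ k)) + tail (φ k)) atTop (𝓝 (f z + D z y)) := by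
    simpa using (((hD z hz y hys).tendsto.comp hlim').const_add (f z)).add
      (htail0.comp hφ.tendsto_atTop)
  refine ge_of_tendsto' hlim2 fun k => ?_
  -- The successor of `x (φ k)` need not converge to `y`; the bound `hle`, valid at every index,
  -- replaces its limit.
  have h1 := hle (φ k + 1)
  have h2 := hstep (φ k) z hz
  have h3 := htail_succ (φ k)
  linarith

theorem posDef_of_posSemidef_sub {m : ℕ} {X : Matrix (Fin m) (Fin m) ℝ} {α : ℝ} (hα : 0 < α)
    (hX : (X - α • (1 : Matrix (Fin m) (Fin m) ℝ)).PosSemidef) : X.PosDef := by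
  have h : (α • (1 : Matrix (Fin m) (Fin m) ℝ)).PosDef := Matrix.PosDef.one.smul hα
  simpa using h.add_posSemidef hX

theorem mulVec_dotProduct_mulVec {m : ℕ} (X Y : Matrix (Fin m) (Fin m) ℝ) (z : Fin m → ℝ) :
    (X *ᵥ z) ⬝ᵥ (Y *ᵥ z) = ∑ i, ∑ j, (Xᵀ * Y) i j * (z i * z j) := by
  have h : (X *ᵥ z) ⬝ᵥ (Y *ᵥ z) = z ⬝ᵥ ((Xᵀ * Y) *ᵥ z) := by
    rw [← Matrix.mulVec_mulVec, Matrix.dotProduct_mulVec z, Matrix.vecMul_transpose]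
  rw [h]
  simp only [dotProduct, Matrix.mulVec, Finset.mul_sum]
  exact Finset.sum_congr rfl fun i _ => Finset.sum_congr rfl fun j _ => by ring

variable {q ℓ n m : ℕ}

/-! ### Decomposition of the surrogate and the deterministic convergence argument -/

namespace Model

/-- The log-determinant divergence of `Ψ(θ)` from `Ψ(θ')`. -/
def logDetGap (M : Model q ℓ n m) (θ θ' : Param q ℓ) : ℝ :=
  ((M.Psi θ')⁻¹ * M.Psi θ).trace - m - (Real.log (M.Psi θ).det - Real.log (M.Psi θ').det)

/-- The deviation from the identity of the empirical second moment matrix of `w`. -/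
def momentError {N : ℕ} (w : Fin N → Fin m → ℝ) (i j : Fin m) : ℝ :=
  1 / (N : ℝ) * ∑ k, w k i * w k j - if i = j then 1 else 0

theorem mcSurrogate_eq (M : Model q ℓ n m) {N : ℕ} (w : Fin N → Fin m → ℝ) {θ θ' : Param q ℓ}
    (hθ' : (M.Psi θ').PosDef) :
    M.mcSurrogate w θ θ' = M.objective θ + (1 / 2) * M.logDetGap θ θ'
      + (1 / 2) * (m - Real.log (M.Psi θ').det)
      + (1 / 2) * ∑ i, ∑ j, ((M.Psi θ')⁻¹ * M.Psi θ) i j * momentError w i j := by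
  have hsymm : ((M.Psi θ')⁻¹)ᵀ = (M.Psi θ')⁻¹ := by
    simpa using hθ'.inv.isHermitian.eq
  have h1 : ∑ i, ∑ j, ((M.Psi θ')⁻¹ * M.Psi θ) i j * momentError w i j
      = 1 / (N : ℝ) * ∑ k, ((M.Psi θ')⁻¹ *ᵥ w k) ⬝ᵥ (M.Psi θ *ᵥ w k)
        - ((M.Psi θ')⁻¹ * M.Psi θ).trace := by
    simp only [mulVec_dotProduct_mulVec, hsymm, momentError, mul_sub, Finset.sum_sub_distrib,
      mul_ite, mul_one, mul_zero, Finset.sum_ite_eq, Finset.mem_univ, if_true, Matrix.trace,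
      Matrix.diag]
    congr 1
    rw [Finset.sum_comm (s := (Finset.univ : Finset (Fin N))), Finset.mul_sum]
    refine Finset.sum_congr rfl fun i _ => ?_
    rw [Finset.sum_comm (s := (Finset.univ : Finset (Fin N))), Finset.mul_sum]
    refine Finset.sum_congr rfl fun j _ => ?_
    rw [← Finset.mul_sum]
    ring
  rw [h1]
  unfold mcSurrogate objective logDetGap
  ring

theorem misfit_eq_sum (M : Model q ℓ n m) (θ : Param q ℓ) :
    M.misfit θ = ∑ i, ∑ j, (M.predMean θ i - M.b i) *
      ((M.Psi θ)⁻¹ i j * (M.predMean θ j - M.b j)) := by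
  simp only [misfit, predMean, dotProduct, Matrix.mulVec, Finset.mul_sum, Pi.sub_apply]

section Regularity

variable {M : Model q ℓ n m} {Θ : Set (Param q ℓ)}

theorem differentiableOn_Psi_inv (hpd : ∀ θ ∈ Θ, (M.Psi θ).PosDef)
    (hΨ : DifferentiableOn ℝ M.Psi Θ) : DifferentiableOn ℝ (fun θ => (M.Psi θ)⁻¹) Θ :=
  fun θ hθ => (differentiableAt_nonsing_inv (hpd θ hθ).isUnit).comp_differentiableWithinAt θ
    (hΨ θ hθ)

theorem differentiableOn_log_det_Psi (hpd : ∀ θ ∈ Θ, (M.Psi θ).PosDef)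
    (hΨ : DifferentiableOn ℝ M.Psi Θ) :
    DifferentiableOn ℝ (fun θ => Real.log (M.Psi θ).det) Θ :=
  (differentiable_det.comp_differentiableOn hΨ).log fun θ hθ => (hpd θ hθ).det_pos.ne'

theorem differentiableOn_objective (hpd : ∀ θ ∈ Θ, (M.Psi θ).PosDef)
    (hΨ : DifferentiableOn ℝ M.Psi Θ) (hmean : DifferentiableOn ℝ M.predMean Θ)
    (hprior : DifferentiableOn ℝ M.logPrior Θ) : DifferentiableOn ℝ M.objective Θ := by
  have hv : ∀ i, DifferentiableOn ℝ (fun θ => M.predMean θ i - M.b i) Θ := fun i =>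
    ((EuclideanSpace.proj i : EuclideanSpace ℝ (Fin m) →L[ℝ] ℝ).differentiable.comp_differentiableOn
      hmean).sub_const _
  have hmis : DifferentiableOn ℝ M.misfit Θ := by
    rw [funext M.misfit_eq_sum]
    refine DifferentiableOn.fun_sum fun i _ => DifferentiableOn.fun_sum fun j _ =>
      (hv i).mul (DifferentiableOn.mul ?_ (hv j))
    exact (differentiable_entry i j).comp_differentiableOn (differentiableOn_Psi_inv hpd hΨ)
  exact (hprior.neg.add ((differentiableOn_log_det_Psi hpd hΨ).const_mul _)).add (hmis.const_mul _)

theorem continuousOn_logDetGap (hpd : ∀ θ ∈ Θ, (M.Psi θ).PosDef)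
    (hΨ : DifferentiableOn ℝ M.Psi Θ) (θ : Param q ℓ) : ContinuousOn (M.logDetGap θ) Θ := by
  have h1 : ContinuousOn (fun θ' => ((M.Psi θ')⁻¹ * M.Psi θ).trace) Θ :=
    differentiable_trace.continuous.comp_continuousOn
      ((differentiableOn_Psi_inv hpd hΨ).continuousOn.mul continuousOn_const)
  exact (h1.sub continuousOn_const).sub
    (continuousOn_const.sub (differentiableOn_log_det_Psi hpd hΨ).continuousOn)

theorem logDetGap_nonneg {θ θ' : Param q ℓ} (hθ : (M.Psi θ).PosDef) (hθ' : (M.Psi θ').PosDef) :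
    0 ≤ M.logDetGap θ θ' := by
  have := log_det_sub_log_det_le hθ' hθ
  unfold logDetGap
  linarith

theorem logDetGap_self {θ : Param q ℓ} (hθ : (M.Psi θ).PosDef) : M.logDetGap θ θ = 0 := by
  simp [logDetGap, Matrix.nonsing_inv_mul _ hθ.det_pos.ne'.isUnit]

/-- The bound of `trace_sub_log_det_le` contains `Ψ(θ) - Ψ(θ')` twice, and the inverses are bounded
on the compact set. -/
theorem exists_logDetGap_le (hΘ : IsCompact Θ) (hpd : ∀ θ ∈ Θ, (M.Psi θ).PosDef)
    (hΨ : DifferentiableOn ℝ M.Psi Θ) {L : ℝ}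
    (hlip : ∀ θ ∈ Θ, ∀ θ' ∈ Θ, ‖M.Psi θ - M.Psi θ'‖ ≤ L * ‖θ - θ'‖) :
    ∃ K, ∀ θ ∈ Θ, ∀ θ' ∈ Θ, M.logDetGap θ θ' ≤ K * ‖θ - θ'‖ ^ 2 := by
  obtain ⟨T, hT⟩ := abs_trace_le (m := m)
  obtain ⟨C, hC⟩ := hΘ.exists_bound_of_continuousOn (differentiableOn_Psi_inv hpd hΨ).continuousOn
  refine ⟨|T| * (L * C * L * C), fun θ hθ θ' hθ' => ?_⟩
  have hC0 : 0 ≤ C := (norm_nonneg _).trans (hC θ hθ)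
  refine (trace_sub_log_det_le (hpd θ' hθ') (hpd θ hθ)).trans ((le_abs_self _).trans ?_)
  refine (hT _).trans ?_
  have hn : ‖(M.Psi θ - M.Psi θ') * (M.Psi θ')⁻¹ * (M.Psi θ - M.Psi θ') * (M.Psi θ)⁻¹‖ ≤
      L * ‖θ - θ'‖ * C * (L * ‖θ - θ'‖) * C := by
    have hl := hlip θ hθ θ' hθ'
    refine norm_mul_le_of_le (norm_mul_le_of_le (norm_mul_le_of_le hl (hC θ' hθ')) hl) (hC θ hθ)
  calc T * _ ≤ |T| * (L * ‖θ - θ'‖ * C * (L * ‖θ - θ'‖) * C) :=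
        mul_le_mul (le_abs_self T) hn (norm_nonneg _) (abs_nonneg T)
    _ = _ := by ring

end Regularity

theorem abs_sum_mul_le {B S : Fin m → Fin m → ℝ} {K e : ℝ} (hB : ∀ i j, |B i j| ≤ K)
    (hS : ∀ i j, |S i j| ≤ e) : |∑ i, ∑ j, B i j * S i j| ≤ m * (m * (K * e)) := by
  have h : ∀ i j, |B i j * S i j| ≤ K * e := fun i j => by
    rw [abs_mul]
    exact mul_le_mul (hB i j) (hS i j) (abs_nonneg _) ((abs_nonneg _).trans (hB i j))
  calc |∑ i, ∑ j, B i j * S i j| ≤ ∑ i : Fin m, ∑ j : Fin m, K * e :=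
        (Finset.abs_sum_le_sum_abs _ _).trans (Finset.sum_le_sum fun i _ =>
          (Finset.abs_sum_le_sum_abs _ _).trans (Finset.sum_le_sum fun j _ => h i j))
    _ = _ := by simp

/-- A run whose empirical second moments deviate summably from the identity has only stationary
accumulation points. -/
theorem isStationaryOn_of_isRun {M : Model q ℓ n m} {Θ : Set (Param q ℓ)} (hΘ : IsCompact Θ)
    (hconv : Convex ℝ Θ) (hpd : ∀ θ ∈ Θ, (M.Psi θ).PosDef) {L : ℝ}
    (hlip : ∀ θ ∈ Θ, ∀ θ' ∈ Θ, ‖M.Psi θ - M.Psi θ'‖ ≤ L * ‖θ - θ'‖)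
    (hΨ : DifferentiableOn ℝ M.Psi Θ) (hmean : DifferentiableOn ℝ M.predMean Θ)
    (hprior : DifferentiableOn ℝ M.logPrior Θ) {N : ℕ → ℕ}
    {w : (t : ℕ) → Fin (N t) → Fin m → ℝ} {x : ℕ → Param q ℓ} (hrun : M.IsRun Θ w x)
    {e : ℕ → ℝ} (he : Summable e) (hw : ∀ t i j, |momentError (w t) i j| ≤ e t)
    {y : Param q ℓ} (hy : MapClusterPt y atTop x) : IsStationaryOn M.objective Θ y := by
  have hx : ∀ t, x t ∈ Θ := fun t => by
    cases t with
    | zero => exact hrun.1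
    | succ t => exact (hrun.2 t).1
  obtain ⟨C, hC⟩ := hΘ.exists_bound_of_continuousOn (differentiableOn_Psi_inv hpd hΨ).continuousOn
  obtain ⟨C', hC'⟩ := hΘ.exists_bound_of_continuousOn hΨ.continuousOn
  obtain ⟨T, hT⟩ := abs_entry_le (m := m)
  have hB : ∀ θ ∈ Θ, ∀ θ' ∈ Θ, ∀ i j, |((M.Psi θ')⁻¹ * M.Psi θ) i j| ≤ |T| * (C * C') := by
    intro θ hθ θ' hθ' i j
    exact (hT _ i j).trans (mul_le_mul (le_abs_self T)
      (norm_mul_le_of_le (hC θ' hθ') (hC' θ hθ)) (norm_nonneg _) (abs_nonneg T))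
  have hF := differentiableOn_objective hpd hΨ hmean hprior
  have hstep : ∀ t, ∀ z ∈ Θ, M.objective (x (t + 1)) ≤
      M.objective z + (1 / 2) * M.logDetGap z (x t) + m * (m * (|T| * (C * C') * e t)) := by
    intro t z hz
    have h1 : M.mcSurrogate (w t) (x (t + 1)) (x t) ≤ M.mcSurrogate (w t) z (x t) :=
      (hrun.2 t).2 hz
    -- The anchor-only term cancels, the divergence at the new iterate is dropped by nonnegativity,
    -- and the two half errors add up to one.
    rw [M.mcSurrogate_eq _ (hpd _ (hx t)), M.mcSurrogate_eq _ (hpd _ (hx t))] at h1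
    have h2 := abs_le.1 (abs_sum_mul_le (hB _ (hx (t + 1)) _ (hx t)) (hw t))
    have h3 := abs_le.1 (abs_sum_mul_le (hB z hz _ (hx t)) (hw t))
    have h4 := logDetGap_nonneg (hpd _ (hx (t + 1))) (hpd _ (hx t))
    linarith [h2.1, h3.2]
  have he' : Summable fun t => m * (m * (|T| * (C * C') * e t)) :=
    ((he.mul_left _).mul_left _).mul_left _
  obtain ⟨hyΘ, hmin⟩ := le_add_of_mapClusterPt hΘ.isClosed hF.continuousOn
    (D := fun z x => (1 / 2) * M.logDetGap z x)
    (fun z _ => continuousOn_const.mul (continuousOn_logDetGap hpd hΨ z))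
    (fun z hz => by simp [logDetGap_self (hpd z hz)]) he' hx hstep hy
  obtain ⟨K, hK⟩ := exists_logDetGap_le hΘ hpd hΨ hlip
  refine ⟨hyΘ, ⟨_, (hF y hyΘ).hasGradientWithinAt⟩, fun g hg z hz =>
    inner_nonneg_of_quadratic_lower_bound hconv hyΘ hz hg (K := 1 / 2 * K) fun z hz => ?_⟩
  have h1 := hmin z hz
  have h2 := hK z hz y hyΘ
  linarith

end Model

/-! ### Rademacher vectors and concentration of their second moments -/

instance isProbabilityMeasure_rademacher : IsProbabilityMeasure rademacher :=
  ⟨by simp [rademacher, ENNReal.inv_two_add_inv_two]⟩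

theorem ae_rademacher : ∀ᵐ x ∂rademacher, x = 1 ∨ x = -1 := by
  rw [rademacher, ae_add_measure_iff]
  exact ⟨Measure.ae_smul_measure (by simp [ae_dirac_eq]) _,
    Measure.ae_smul_measure (by simp [ae_dirac_eq]) _⟩

theorem integral_id_rademacher : ∫ x, x ∂rademacher = 0 := by
  rw [rademacher, integral_add_measure ((integrable_dirac (by simp)).smul_measure (by simp))
    ((integrable_dirac (by simp)).smul_measure (by simp)), integral_smul_measure, integral_smul_measure]
  simp

instance isProbabilityMeasure_rademacherVector (m : ℕ) :
    IsProbabilityMeasure (rademacherVector m) := by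
  unfold rademacherVector
  infer_instance

theorem ae_rademacherVector (m : ℕ) :
    ∀ᵐ x ∂rademacherVector m, ∀ i, x i = 1 ∨ x i = -1 := by
  rw [ae_all_iff]
  intro i
  exact (Measure.quasiMeasurePreserving_eval (fun _ : Fin m => rademacher) i).ae ae_rademacher

theorem integral_mul_rademacherVector {m : ℕ} {i j : Fin m} (hij : i ≠ j) :
    ∫ x, x i * x j ∂rademacherVector m = 0 := by
  have hind : iIndepFun (fun (k : Fin m) (x : Fin m → ℝ) => x k) (rademacherVector m) :=
    iIndepFun_pi (X := fun _ x => x) fun _ => aemeasurable_id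
  rw [(hind.indepFun hij).integral_fun_mul_eq_mul_integral
    (measurable_pi_apply i).aestronglyMeasurable (measurable_pi_apply j).aestronglyMeasurable]
  have h : ∫ x : Fin m → ℝ, x i ∂rademacherVector m = 0 := by
    have := integral_comp_eval (μ := fun _ : Fin m => rademacher) (i := i) (f := fun x : ℝ => x)
      (by fun_prop)
    rw [rademacherVector, this, integral_id_rademacher]
  rw [h, zero_mul]

section Concentration

variable {Ω : Type*} [MeasurableSpace Ω] {P : Measure Ω} [IsProbabilityMeasure P] {m N : ℕ}
  {w : Fin N → Ω → Fin m → ℝ}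

/-- A product of two distinct coordinates is centered by independence and lies in `[-1, 1]`, so
Hoeffding's lemma gives variance proxy `1`. The sign `s` serves both tails. -/
theorem hasSubgaussianMGF_mul {X : Ω → Fin m → ℝ} (hX : HasLaw X (rademacherVector m) P)
    {i j : Fin m} (hij : i ≠ j) (s : ℝ) (hs : s = 1 ∨ s = -1) :
    HasSubgaussianMGF (fun ω => s * (X ω i * X ω j)) 1 P := by
  have hm : AEMeasurable (fun ω => s * (X ω i * X ω j)) P := by
    have h : ∀ k, AEMeasurable (fun ω => X ω k) P := fun k =>
      (measurable_pi_apply k).comp_aemeasurable hX.aemeasurable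
    exact ((h i).mul (h j)).const_mul s
  have hb : ∀ᵐ ω ∂P, s * (X ω i * X ω j) ∈ Set.Icc (-1 : ℝ) 1 := by
    have h := ae_of_ae_map hX.aemeasurable (by rw [hX.map_eq]; exact ae_rademacherVector m)
    filter_upwards [h] with ω hω
    rcases hs with rfl | rfl <;> rcases hω i with h | h <;> rcases hω j with h' | h' <;>
      norm_num [h, h']
  have hc : P[fun ω => s * (X ω i * X ω j)] = 0 := by
    rw [integral_const_mul]
    have := hX.integral_comp (f := fun x : Fin m → ℝ => x i * x j) (by fun_prop)
    simp only [Function.comp_def] at this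
    rw [this, integral_mul_rademacherVector hij, mul_zero]
  have := hasSubgaussianMGF_of_mem_Icc_of_integral_eq_zero hm hb hc
  convert this using 1
  ext
  norm_num

theorem measure_sum_mul_ge_le (hlaw : ∀ k, HasLaw (w k) (rademacherVector m) P)
    (hind : iIndepFun w P) {i j : Fin m} (hij : i ≠ j) {s : ℝ} (hs : s = 1 ∨ s = -1) {a : ℝ}
    (ha : 0 ≤ a) :
    P.real {ω | N * a ≤ ∑ k, s * (w k ω i * w k ω j)} ≤ Real.exp (-(N * a ^ 2 / 2)) := by
  have hind' : iIndepFun (fun k ω => s * (w k ω i * w k ω j)) P :=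
    hind.comp (fun _ x => s * (x i * x j)) fun _ => by fun_prop
  have h := HasSubgaussianMGF.measure_sum_ge_le_of_iIndepFun hind' (c := fun _ => 1)
    (s := Finset.univ) (fun k _ => hasSubgaussianMGF_mul (hlaw k) hij s hs)
    (ε := N * a) (by positivity)
  refine h.trans (Real.exp_le_exp.2 ?_)
  rcases Nat.eq_zero_or_pos N with rfl | hN
  · simp
  · have : (0 : ℝ) < N := by exact_mod_cast hN
    simp only [Finset.sum_const, Finset.card_univ, Fintype.card_fin, nsmul_eq_mul, mul_one,
      NNReal.coe_natCast]
    apply le_of_eq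
    field_simp

/-- Diagonal entries carry almost surely no error because squared signs are `1`; off the diagonal,
Hoeffding is used once per tail. -/
theorem measure_momentError_gt_le (hlaw : ∀ k, HasLaw (w k) (rademacherVector m) P)
    (hind : iIndepFun w P) (hN : 0 < N) {a : ℝ} (ha : 0 ≤ a) (i j : Fin m) :
    P.real {ω | a < |Model.momentError (fun k => w k ω) i j|}
      ≤ 2 * Real.exp (-(N * a ^ 2 / 2)) := by
  have hN' : (0 : ℝ) < N := by exact_mod_cast hN
  rcases eq_or_ne i j with rfl | hij
  · have h0 : P.real {ω | a < |Model.momentError (fun k => w k ω) i i|} = 0 := by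
      rw [measureReal_eq_zero_iff]
      have h : ∀ᵐ ω ∂P, ∀ k, w k ω i = 1 ∨ w k ω i = -1 := ae_all_iff.2 fun k =>
        (ae_of_ae_map (p := fun x : Fin m → ℝ => ∀ i, x i = 1 ∨ x i = -1) (hlaw k).aemeasurable
          (by rw [(hlaw k).map_eq]; exact ae_rademacherVector m)).mono fun ω h => h i
      refine measure_mono_null ?_ (ae_iff.1 h)
      intro ω hω hk
      have h1 : ∀ k, w k ω i * w k ω i = 1 := fun k => by rcases hk k with h | h <;> norm_num [h]
      simp only [Set.mem_ofPred_eq, Model.momentError, h1, if_true] at hω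
      simp [hN'.ne'] at hω
      linarith
    rw [h0]
    positivity
  · have hsub : {ω | a < |Model.momentError (fun k => w k ω) i j|} ⊆
        {ω | N * a ≤ ∑ k, 1 * (w k ω i * w k ω j)} ∪
          {ω | N * a ≤ ∑ k, (-1) * (w k ω i * w k ω j)} := by
      intro ω hω
      simp only [Set.mem_ofPred_eq, Model.momentError, hij, if_false, sub_zero] at hω
      rw [abs_mul, abs_of_nonneg (by positivity : (0 : ℝ) ≤ 1 / N), one_div,
        inv_mul_eq_div, lt_div_iff₀ hN'] at hω
      rcases le_abs.1 hω.le with h | h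
      · left; simp only [Set.mem_ofPred_eq, one_mul]; linarith
      · right; simp only [Set.mem_ofPred_eq, ← Finset.mul_sum]; linarith
    calc _ ≤ _ := measureReal_mono hsub
      _ ≤ _ := measureReal_union_le _ _
      _ ≤ _ := add_le_add (measure_sum_mul_ge_le hlaw hind hij (Or.inl rfl) ha)
          (measure_sum_mul_ge_le hlaw hind hij (Or.inr rfl) ha)
      _ = _ := by ring

theorem measure_exists_momentError_gt_le (hlaw : ∀ k, HasLaw (w k) (rademacherVector m) P)
    (hind : iIndepFun w P) (hN : 0 < N) {a : ℝ} (ha : 0 ≤ a) :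
    P.real {ω | ∃ i j, a < |Model.momentError (fun k => w k ω) i j|}
      ≤ m * (m * (2 * Real.exp (-(N * a ^ 2 / 2)))) := by
  have : {ω | ∃ i j, a < |Model.momentError (fun k => w k ω) i j|} =
      ⋃ i, ⋃ j, {ω | a < |Model.momentError (fun k => w k ω) i j|} := by
    ext; simp
  rw [this]
  calc _ ≤ ∑ i : Fin m, ∑ j : Fin m, P.real {ω | a < |Model.momentError (fun k => w k ω) i j|} :=
        (measureReal_iUnion_fintype_le _).trans (Finset.sum_le_sum fun i _ =>
          measureReal_iUnion_fintype_le _)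
    _ ≤ ∑ i : Fin m, ∑ j : Fin m, 2 * Real.exp (-(N * a ^ 2 / 2)) :=
        Finset.sum_le_sum fun i _ => Finset.sum_le_sum fun j _ =>
          measure_momentError_gt_le hlaw hind hN ha i j
    _ = _ := by simp

/-- The sample size needed for the tolerance `m * ε` with failure probability `δ`. -/
theorem measure_exists_momentError_gt_le_of_le (hlaw : ∀ k, HasLaw (w k) (rademacherVector m) P)
    (hind : iIndepFun w P) {ε δ : ℝ} (hε : 0 < ε) (hδ : 0 < δ) (hδ1 : δ < 1)
    (hN : 0 < m → 32 / ε ^ 2 * Real.log (2 / δ) ≤ N) :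
    P.real {ω | ∃ i j, m * ε < |Model.momentError (fun k => w k ω) i j|} ≤ δ := by
  rcases Nat.eq_zero_or_pos m with rfl | hm
  · simp [hδ.le]
  specialize hN hm
  have hlog : 1 / 2 ≤ Real.log (2 / δ) := by
    have h2 : (2 : ℝ) ≤ 2 / δ := by rw [le_div_iff₀ hδ]; linarith
    have := Real.log_le_log (by norm_num) h2
    linarith [Real.log_two_gt_d9]
  have hm1 : (1 : ℝ) ≤ m := by exact_mod_cast hm
  have hNpos : 0 < N := by
    have : (0 : ℝ) < N := lt_of_lt_of_le (by positivity) hN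
    exact_mod_cast this
  refine (measure_exists_momentError_gt_le hlaw hind hNpos (by positivity)).trans ?_
  have hexp : 16 * (m : ℝ) ^ 2 * Real.log (2 / δ) ≤ N * (m * ε) ^ 2 / 2 := by
    calc 16 * (m : ℝ) ^ 2 * Real.log (2 / δ)
        = 32 / ε ^ 2 * Real.log (2 / δ) * ((m * ε) ^ 2 / 2) := by field_simp; ring
      _ ≤ N * ((m * ε) ^ 2 / 2) := mul_le_mul_of_nonneg_right hN (by positivity)
      _ = _ := by ring
  -- Since `m ≥ 1` and `log (2/δ) ≥ 1/2`, the exponent splits: `exp (-m²)` pays for the union over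
  -- `m²` entries, and the rest supplies `δ / 2`.
  have hsplit : (m : ℝ) ^ 2 + Real.log (2 / δ) ≤ N * (m * ε) ^ 2 / 2 := by
    have : 1 ≤ (m : ℝ) ^ 2 := one_le_pow₀ hm1
    nlinarith
  have hexp2 : Real.exp (-(N * (m * ε) ^ 2 / 2)) ≤ Real.exp (-(m : ℝ) ^ 2) * (δ / 2) := by
    have : δ / 2 = Real.exp (-Real.log (2 / δ)) := by
      rw [Real.exp_neg, Real.exp_log (by positivity), inv_div]
    rw [this, ← Real.exp_add]
    exact Real.exp_le_exp.2 (by linarith)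
  have hm2 : (m : ℝ) ^ 2 * Real.exp (-(m : ℝ) ^ 2) ≤ 1 := by
    rw [Real.exp_neg, ← div_eq_mul_inv, div_le_one (Real.exp_pos _)]
    linarith [Real.add_one_le_exp ((m : ℝ) ^ 2)]
  calc m * (m * (2 * Real.exp (-(N * (m * ε) ^ 2 / 2))))
      ≤ m * (m * (2 * (Real.exp (-(m : ℝ) ^ 2) * (δ / 2)))) := by gcongr
    _ = (m : ℝ) ^ 2 * Real.exp (-(m : ℝ) ^ 2) * δ := by ring
    _ ≤ 1 * δ := by gcongr
    _ = δ := one_mul δ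

end Concentration

/-! ### Sample sizes, the union bound and the conclusion -/

/-- From `Ψ ⪰ α I`, a diagonal entry is at least `α`, hence so is the Frobenius norm. This needs `m
> 0`. -/
theorem one_le_sigmaF {q ℓ n m : ℕ} {M : Model q ℓ n m} {Θ : Set (Param q ℓ)} (hΘ : IsCompact Θ)
    (hne : Θ.Nonempty) (hm : 0 < m) (hΨ : ContinuousOn M.Psi Θ) {α : ℝ} (hα : 0 < α)
    (hlower : ∀ θ ∈ Θ, (M.Psi θ - α • (1 : Matrix (Fin m) (Fin m) ℝ)).PosSemidef) :
    1 ≤ M.sigmaF Θ α := by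
  obtain ⟨θ, hθ⟩ := hne
  have hcont : ContinuousOn (fun θ => Real.sqrt (∑ i, ∑ j, (M.Psi θ i j) ^ 2)) Θ := by
    refine Real.continuous_sqrt.comp_continuousOn (continuousOn_finsetSum _ fun i _ =>
      continuousOn_finsetSum _ fun j _ => ContinuousOn.pow ?_ 2)
    exact (differentiable_entry i j).continuous.comp_continuousOn hΨ
  -- Compactness is essential here: the `sSup` of an unbounded set of reals defaults to `0`.
  have hle := le_csSup (hΘ.image_of_continuousOn hcont).bddAbove (Set.mem_image_of_mem _ hθ)
  let k : Fin m := ⟨0, hm⟩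
  have hdiag : α ≤ M.Psi θ k k := by
    have := (hlower θ hθ).diag_nonneg (i := k)
    simpa using this
  have hentry : α ≤ Real.sqrt (∑ i, ∑ j, (M.Psi θ i j) ^ 2) := by
    refine Real.le_sqrt_of_sq_le ((pow_le_pow_left₀ hα.le hdiag 2).trans ?_)
    calc (M.Psi θ k k) ^ 2 ≤ ∑ j, (M.Psi θ k j) ^ 2 :=
          Finset.single_le_sum (f := fun j => (M.Psi θ k j) ^ 2) (fun j _ => sq_nonneg _)
            (Finset.mem_univ k)
      _ ≤ _ := Finset.single_le_sum (f := fun i => ∑ j, (M.Psi θ i j) ^ 2)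
            (fun i _ => Finset.sum_nonneg fun j _ => sq_nonneg _) (Finset.mem_univ k)
  unfold Model.sigmaF
  rw [one_div, inv_mul_eq_div, le_div_iff₀ hα, one_mul]
  exact hentry.trans hle

theorem sigmaTwo_nonneg {q ℓ n m : ℕ} (M : Model q ℓ n m) (Θ : Set (Param q ℓ)) {α : ℝ}
    (hα : 0 < α) : 0 ≤ M.sigmaTwo Θ α := by
  refine mul_nonneg (by positivity) (Real.sSup_nonneg ?_)
  rintro _ ⟨θ, _, rfl⟩
  exact norm_nonneg _

theorem HasLipschitzDerivOn.differentiableOn {E F : Type*} [NormedAddCommGroup E]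
    [NormedSpace ℝ E] [NormedAddCommGroup F] [NormedSpace ℝ F] {f : E → F} {s : Set E}
    (h : HasLipschitzDerivOn f s) : DifferentiableOn ℝ f s := by
  obtain ⟨f', _, hf, _⟩ := h
  exact fun x hx => (hf x hx).differentiableWithinAt

/-- The prescribed sample size dominates the one needed for entrywise concentration. -/
theorem log_le_sampleSize {σF σ2 ε δ γ N : ℝ} (hF : 1 ≤ σF) (h2 : 0 ≤ σ2) (hε : 0 < ε)
    (hδ : 0 < δ) (hδ1 : δ < 1) (hγ : 1 ≤ γ)
    (hN : 16 * (2 * σF ^ 2 + ε * σ2) / ε ^ 2 * Real.log (2 * γ / δ) ≤ N) :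
    32 / ε ^ 2 * Real.log (2 / δ) ≤ N := by
  refine le_trans ?_ hN
  have hlog : Real.log (2 / δ) ≤ Real.log (2 * γ / δ) := by
    refine Real.log_le_log (by positivity) ?_
    gcongr
    linarith
  have hlog0 : 0 ≤ Real.log (2 / δ) := Real.log_nonneg (by rw [le_div_iff₀ hδ]; linarith)
  have hF2 : 1 ≤ σF ^ 2 := one_le_pow₀ hF
  have hcoef : 32 ≤ 16 * (2 * σF ^ 2 + ε * σ2) := by
    have := mul_nonneg hε.le h2
    linarith
  exact mul_le_mul (by gcongr) hlog hlog0 (by positivity)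

theorem exists_measurableSet_compl_iUnion {Ω : Type*} [MeasurableSpace Ω] {P : Measure Ω}
    [IsProbabilityMeasure P] {p : Ω → Prop} (hp : ∀ᵐ ω ∂P, p ω) {B : ℕ → Set Ω} {δs : ℕ → ℝ}
    {δ : ℝ} (hδs : ∀ t, 0 ≤ δs t) (hsum : HasSum δs δ) (hB : ∀ t, P.real (B t) ≤ δs t) :
    ∃ S : Set Ω, MeasurableSet S ∧ ENNReal.ofReal (1 - δ) ≤ P S ∧
      ∀ ω ∈ S, p ω ∧ ∀ t, ω ∉ B t := by
  set U : Set Ω := {ω | ¬ p ω} ∪ ⋃ t, B t with hU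
  have hPU : P U ≤ ENNReal.ofReal δ := by
    calc P U ≤ P {ω | ¬ p ω} + P (⋃ t, B t) := measure_union_le _ _
      _ = P (⋃ t, B t) := by rw [ae_iff.1 hp, zero_add]
      _ ≤ ∑' t, P (B t) := measure_iUnion_le _
      _ ≤ ∑' t, ENNReal.ofReal (δs t) := ENNReal.tsum_le_tsum fun t => by
          rw [← ofReal_measureReal]
          exact ENNReal.ofReal_le_ofReal (hB t)
      _ = ENNReal.ofReal δ := by
          rw [← ENNReal.ofReal_tsum_of_nonneg hδs hsum.summable, hsum.tsum_eq]
  -- The bad set need not be measurable, so its measurable hull, of equal measure, is removed.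
  refine ⟨(toMeasurable P U)ᶜ, (measurableSet_toMeasurable P U).compl, ?_, fun ω hω => ?_⟩
  · rw [prob_compl_eq_one_sub (measurableSet_toMeasurable P U), measure_toMeasurable,
      ENNReal.ofReal_sub 1 (hsum.nonneg hδs), ENNReal.ofReal_one]
    exact tsub_le_tsub_left hPU 1
  · have h : ω ∉ U := fun h => hω (subset_toMeasurable P U h)
    simp only [hU, Set.mem_union, Set.mem_iUnion, not_or, not_exists] at h
    exact ⟨not_not.1 h.1, h.2⟩

end M3C

end

theorem mainTheorem1 {q ℓ n m : ℕ} (M : M3C.Model q ℓ n m)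
    -- the parameter set: compact, convex, inside a ball of radius `r`
    (Θ : Set (M3C.Param q ℓ)) (hΘ_compact : IsCompact Θ) (hΘ_convex : Convex ℝ Θ)
    (θc : M3C.Param q ℓ) (r : ℝ) (hr : 0 < r) (hΘ_ball : Θ ⊆ Metric.closedBall θc r)
    -- covariances are SPD and prior densities are positive on `Θ`
    (hQ : ∀ θ ∈ Θ, (M.Q (M3C.psiPart θ)).PosDef)
    (hR : ∀ θ ∈ Θ, (M.R (M3C.psiPart θ)).PosDef)
    (hpriorPsi : ∀ θ ∈ Θ, 0 < M.priorPsi (M3C.psiPart θ))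
    (hpriorY : ∀ θ ∈ Θ, 0 < M.priorY (M3C.yPart θ))
    -- `Ψ` is Lipschitz in the spectral norm and `α I ⪯ Ψ ⪯ β I`
    (LΨ α β : ℝ) (hLΨ : 0 < LΨ) (hα : 0 < α) (hαβ : α ≤ β)
    (hΨ_lip : ∀ θ ∈ Θ, ∀ θ' ∈ Θ, ‖M.Psi θ - M.Psi θ'‖ ≤ LΨ * ‖θ - θ'‖)
    (hΨ_lower : ∀ θ ∈ Θ, (M.Psi θ - α • (1 : Matrix (Fin m) (Fin m) ℝ)).PosSemidef)
    (hΨ_upper : ∀ θ ∈ Θ, (β • (1 : Matrix (Fin m) (Fin m) ℝ) - M.Psi θ).PosSemidef)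
    -- Lipschitz gradients on `Θ`
    (h_mean : M3C.HasLipschitzDerivOn M.predMean Θ)
    (h_Psi : M3C.HasLipschitzDerivOn M.Psi Θ)
    (h_prior : M3C.HasLipschitzDerivOn M.logPrior Θ)
    -- tolerances and failure probabilities
    (ε δs : ℕ → ℝ) (δ : ℝ) (hε_pos : ∀ t, 0 < ε t) (hε_sum : Summable ε)
    (hδs_pos : ∀ t, 0 < δs t) (hδs_sum : HasSum δs δ) (hδ : δ < 1)
    -- sample sizes
    (N : ℕ → ℕ)
    (hN : ∀ t, 16 * (2 * M.sigmaF Θ α ^ 2 + ε t * M.sigmaTwo Θ α) / ε t ^ 2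
      * Real.log (2 * M3C.coveringFactor (q + ℓ) m r LΨ α (ε t) / δs t) ≤ (N t : ℝ))
    -- at each iteration `t`, the `N t` sample vectors are independent Rademacher vectors
    {Ω : Type*} [MeasurableSpace Ω] (P : MeasureTheory.Measure Ω)
    [MeasureTheory.IsProbabilityMeasure P]
    (w : (t : ℕ) → Fin (N t) → Ω → (Fin m → ℝ))
    (hw_law : ∀ t i, ProbabilityTheory.HasLaw (w t i) (M3C.rademacherVector m) P)
    (hw_indep : ∀ t, ProbabilityTheory.iIndepFun (w t) P)
    -- the random sequence of iterates
    (θhat : ℕ → Ω → M3C.Param q ℓ)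
    (hθhat : ∀ᵐ ω ∂P, M.IsRun Θ (fun t i => w t i ω) (fun t => θhat t ω)) :
    -- with probability at least `1 - δ`, all accumulation points are stationary points of `F`
    ∃ S : Set Ω, MeasurableSet S ∧ ENNReal.ofReal (1 - δ) ≤ P S ∧
      ∀ ω ∈ S, ∀ θstar : M3C.Param q ℓ,
        MapClusterPt θstar Filter.atTop (fun t => θhat t ω) →
          M3C.IsStationaryOn M.objective Θ θstar := by
  have hpd : ∀ θ ∈ Θ, (M.Psi θ).PosDef := fun θ hθ =>
    M3C.posDef_of_posSemidef_sub hα (hΨ_lower θ hθ)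
  -- Almost every run starts in `Θ`, and a probability space has such an outcome.
  have hne : Θ.Nonempty := by
    obtain ⟨ω, hω⟩ := hθhat.exists
    exact ⟨_, hω.1⟩
  have hδs_lt : ∀ t, δs t < 1 := fun t =>
    (le_hasSum hδs_sum t fun j _ => (hδs_pos j).le).trans_lt hδ
  have hbad : ∀ t, P.real {ω | ∃ i j, m * ε t < |M3C.Model.momentError (fun k => w t k ω) i j|}
      ≤ δs t := fun t =>
    M3C.measure_exists_momentError_gt_le_of_le (hw_law t) (hw_indep t) (hε_pos t) (hδs_pos t)
      (hδs_lt t) fun hm => M3C.log_le_sampleSize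
        (M3C.one_le_sigmaF hΘ_compact hne hm h_Psi.differentiableOn.continuousOn hα hΨ_lower)
        (M3C.sigmaTwo_nonneg M Θ hα) (hε_pos t) (hδs_pos t) (hδs_lt t) (le_max_right _ _) (hN t)
  obtain ⟨S, hS, hPS, hgood⟩ := M3C.exists_measurableSet_compl_iUnion hθhat
    (fun t => (hδs_pos t).le) hδs_sum hbad
  refine ⟨S, hS, hPS, fun ω hω θstar hstar => ?_⟩
  obtain ⟨hrun, hw⟩ := hgood ω hω
  refine M3C.Model.isStationaryOn_of_isRun hΘ_compact hΘ_convex hpd hΨ_lip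
    h_Psi.differentiableOn h_mean.differentiableOn h_prior.differentiableOn hrun
    (hε_sum.mul_left (m : ℝ)) (fun t i j => ?_) hstar
  by_contra! h
  exact hw t ⟨i, j, h⟩
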